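/- **Lemma (a Rankine–Hugoniot condition).** Let $\Omega\subset\mathbb R^d$ be bounded, open and connected, and let $\alpha,\beta>1$. Let $G:\mathbb R\to\mathbb R$ be $C^1$, convex and non-decreasing, with $G(z)/z\to\infty$ as $z\to+\infty$, and suppose that for some $C>0$ and all sufficiently large $z$ $$\tfrac{|z|^\alpha}{C}-C\le G(z)\le C(|z|^\alpha+1),\qquad |G'(z)|\le C(|z|^{\alpha-1}+1),\qquad G'(z)z\ge -C .$$ For $\mu\in G'(\mathbb R)$ put $g(\mu)=\max\{z\in\mathbb R: G'(z)=\mu\}$. Let $H:\overline\Omega\times\mathbb R^d\to\mathbb R$ be $C^2$ and bounded below, with $p\mapsto H(x,p)$ strictly convex (for instance uniformly convex) for every $x\in\Omega$, and suppose that for some $C>0$ and all $(x,p)\in\Omega\times\mathbb R^d$ $$\tfrac{|p|^\beta}{C}-C\le H(x,p)\le C(|p|^\beta+1),\quad |D_xH(x,p)|\le C(|p|^\beta+1),\quad |D_pH(x,p)|\le C(|p|^{\beta-1}+1),$$ $$-H(x,p)+D_pH(x,p)\cdot p\ge \tfrac{|p|^\beta}{C}-C .$$ Let $(m,u)\in L^{\alpha'}(\Omega)\times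 W^{1,\gamma}(\Omega)$, where $\alpha'=\alpha/(\alpha-1)$ and $\gamma=\alpha\beta$, be a weak solution in $\Omega$ of the mean-field game system $$H(x,Du)=g(m),\qquad -\operatorname{div}\bigl(m\,D_pH(x,Du)\bigr)=0 ,$$ that is: $m\ge0$ and $m\in G'(\mathbb R)$ a.e. in $\Omega$; $m\,D_pH(x,Du)\in L^1(\Omega)$; $H(x,Du)=g(m)$ a.e. in $\{m>0\}$ and $H(x,Du)\le g(m)$ a.e. in $\Omega$; and the second equation holds in the sense of distributions in $\Omega$. (No condition on $\partial\Omega$ is needed; in particular the statement applies to weak solutions with any boundary conditions, such as mixed Neumann and contact-set conditions.) Fix representatives of $m$ and of the weak gradient $Du$, and let $$F_m:=\partial\{x\in\Omega: m(x)>0\}\cap\Omega$$ be the free boundary of $m$. Let $x_0\in F_m$. Suppose that $F_m$ is $C^1$ near $x_0$ and divides a neighborhood of $x_0$ into two sides, on one of which $m\equiv0$ and on the other of which $m>0$: there are an open set $U$ with $x_0\in U\subset\Omega$ and a function $\rho\in C^1(U)$ with $D\rho\ne0$ on $U$ such that $F_m\cap U=\{x\in U:\rho(x)=0\}$, $m=0$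 on $V_L:=\{x\in U:\rho(x)<0\}$ and $m>0$ on $V_R:=\{x\in U:\rho(x)>0\}$. Suppose also that the one-sided limits $$m_R(x_0)=\lim_{V_R\ni z\to x_0}m(z)\in\mathbb R,\qquad \mathsf v_R(x_0)=\lim_{V_R\ni z\to x_0}Du(z)\in\mathbb R^d$$ exist, and let $\nu(x_0)$ be a unit normal to $F_m$ at $x_0$. Then $$m_R(x_0)\,D_pH(x_0,\mathsf v_R(x_0))\cdot\nu(x_0)=0 ,$$ i.e. the flux at the free boundary is tangential to it. -/

import Mathlib

open MeasureTheory Filter Topology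
open scoped ContDiff

noncomputable section

namespace MFG

/-- Euclidean `d`-space with its inner product norm. -/
abbrev Euc (d : ℕ) : Type := EuclideanSpace ℝ (Fin d)

/-- The free boundary `∂{x ∈ Ω : μ x > 0} ∩ Ω` of a function `μ` on `Ω`. -/
def freeBoundary {d : ℕ} (Ω : Set (Euc d)) (μ : Euc d → ℝ) : Set (Euc d) :=
  frontier {x | x ∈ Ω ∧ 0 < μ x} ∩ Ω

/-- The gradient `D_p H(x, p)` of the Hamiltonian in the momentum variable. -/
def gradP {d : ℕ} (H : Euc d → Euc d → ℝ) (x p : Euc d) : Euc d :=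
  gradient (fun q => H x q) p

/-- The gradient `D_x H(x, p)` of the Hamiltonian in the space variable. -/
def gradX {d : ℕ} (H : Euc d → Euc d → ℝ) (x p : Euc d) : Euc d :=
  gradient (fun y => H y p) x

/-- The pseudo-inverse `g μ = max {z : G' z = μ}` of `G'`.
It is meaningful for `μ` in the range of `G'` (the maximum need not exist otherwise). -/
def pseudoInverse (G : ℝ → ℝ) (μ : ℝ) : ℝ :=
  sSup {z : ℝ | deriv G z = μ}

/-- Assumptions on the energy `G`, with growth exponent `α`. -/
structure EnergyAssumption (G : ℝ → ℝ) (α : ℝ) : Prop where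
  contDiff : ContDiff ℝ 1 G
  coercive : Tendsto (fun z => G z / z) atTop atTop
  convex : ConvexOn ℝ Set.univ G
  monotone : Monotone G
  one_lt : 1 < α
  growth : ∃ C : ℝ, 0 < C ∧ ∀ᶠ z : ℝ in atTop,
    |z| ^ α / C - C ≤ G z ∧ G z ≤ C * (|z| ^ α + 1) ∧ |deriv G z| ≤ C * (|z| ^ (α - 1) + 1)
  deriv_mul_ge : ∃ C : ℝ, 0 < C ∧ ∀ᶠ z : ℝ in atTop, -C ≤ deriv G z * z

/-- Assumptions on the Hamiltonian `H` on `closure Ω × ℝᵈ`, with growth exponent `β`.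
Only strict convexity in `p` is asked for; uniform convexity implies it. -/
structure HamiltonianAssumption {d : ℕ} (Ω : Set (Euc d)) (H : Euc d → Euc d → ℝ) (β : ℝ) :
    Prop where
  contDiffOn : ContDiffOn ℝ 2 (fun z : Euc d × Euc d => H z.1 z.2) (closure Ω ×ˢ Set.univ)
  bddBelow : ∃ c : ℝ, ∀ x ∈ closure Ω, ∀ p, c ≤ H x p
  strictConvex : ∀ x ∈ Ω, StrictConvexOn ℝ Set.univ (H x)
  one_lt : 1 < β
  growth : ∃ C : ℝ, 0 < C ∧ ∀ x ∈ Ω, ∀ p,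
    ‖p‖ ^ β / C - C ≤ H x p ∧ H x p ≤ C * (‖p‖ ^ β + 1) ∧
    ‖gradX H x p‖ ≤ C * (‖p‖ ^ β + 1) ∧
    ‖gradP H x p‖ ≤ C * (‖p‖ ^ (β - 1) + 1)
  lower : ∃ C : ℝ, 0 < C ∧ ∀ x ∈ Ω, ∀ p,
    ‖p‖ ^ β / C - C ≤ -H x p + inner ℝ (gradP H x p) p

/-- `φ ∈ C_c^∞(Ω)`. -/
structure IsTestFunction {d : ℕ} (Ω : Set (Euc d)) (φ : Euc d → ℝ) : Prop where
  smooth : ContDiff ℝ ∞ φ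
  compact : HasCompactSupport φ
  support : tsupport φ ⊆ Ω

/-- `v` is (a representative of) the weak gradient of `u` in `Ω`. -/
def HasWeakGradient {d : ℕ} (Ω : Set (Euc d)) (u : Euc d → ℝ) (v : Euc d → Euc d) : Prop :=
  LocallyIntegrableOn u Ω ∧ LocallyIntegrableOn v Ω ∧
  ∀ φ : Euc d → ℝ, IsTestFunction Ω φ → ∀ e : Euc d,
    ∫ x in Ω, u x * inner ℝ (gradient φ x) e = - ∫ x in Ω, inner ℝ (v x) e * φ x

/-- `(m, u)` is a weak solution in `Ω` of
`H(x, Du) = g(m)`, `-div (m D_pH(x, Du)) = 0`, where `g` is the pseudo-inverse of `G'`;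
`v` is a representative of `Du`. The function spaces are `m ∈ L^{α'}(Ω)`, `u ∈ W^{1,γ}(Ω)`
with `α' = α / (α - 1)` and `γ = α β`. No boundary condition is part of this definition. -/
structure IsWeakSolution {d : ℕ} (Ω : Set (Euc d)) (G : ℝ → ℝ) (H : Euc d → Euc d → ℝ)
    (α β : ℝ) (m u : Euc d → ℝ) (v : Euc d → Euc d) : Prop where
  memLp_m : MemLp m (ENNReal.ofReal (α / (α - 1))) (volume.restrict Ω)
  memLp_u : MemLp u (ENNReal.ofReal (α * β)) (volume.restrict Ω)
  memLp_v : MemLp v (ENNReal.ofReal (α * β)) (volume.restrict Ω)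
  weakGradient : HasWeakGradient Ω u v
  nonneg : ∀ᵐ x ∂(volume.restrict Ω), 0 ≤ m x
  flux_integrable : IntegrableOn (fun x => m x • gradP H x (v x)) Ω
  mem_range : ∀ᵐ x ∂(volume.restrict Ω), m x ∈ Set.range (deriv G)
  hamiltonJacobi_eq : ∀ᵐ x ∂(volume.restrict Ω), 0 < m x → H x (v x) = pseudoInverse G (m x)
  hamiltonJacobi_le : ∀ᵐ x ∂(volume.restrict Ω), H x (v x) ≤ pseudoInverse G (m x)
  continuity : ∀ φ : Euc d → ℝ, IsTestFunction Ω φ →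
    ∫ x in Ω, inner ℝ (m x • gradP H x (v x)) (gradient φ x) = 0

/-- Near `x₀`, the set `F` is a `C¹` hypersurface, with `C¹` defining function `ρ` on the open
neighborhood `U` of `x₀`, and it divides `U` into its two sides `VL = {ρ < 0}` and
`VR = {ρ > 0}`. -/
structure DividesC1 {d : ℕ} (F : Set (Euc d)) (x₀ : Euc d) (U VL VR : Set (Euc d))
    (ρ : Euc d → ℝ) : Prop where
  isOpen : IsOpen U
  mem : x₀ ∈ U
  contDiffOn : ContDiffOn ℝ 1 ρ U
  gradient_ne_zero : ∀ x ∈ U, gradient ρ x ≠ 0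
  eq_zero : F ∩ U = {x | x ∈ U ∧ ρ x = 0}
  left_eq : VL = {x | x ∈ U ∧ ρ x < 0}
  right_eq : VR = {x | x ∈ U ∧ 0 < ρ x}

/-- `ν` is a unit normal at `x₀` to the level set of `ρ` through `x₀` (either orientation). -/
def IsUnitNormal {d : ℕ} (ρ : Euc d → ℝ) (x₀ ν : Euc d) : Prop :=
  ‖ν‖ = 1 ∧ ∃ c : ℝ, ν = c • gradient ρ x₀

end MFG

end

/-!
Blowing up at `x₀` turns the flux, which is bounded near `x₀` and divergence free, into a field
that equals a constant `w` on a half-space, vanishes on the opposite one, and is still divergence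
free. Mollifying the indicator of the half-space therefore gives a function that is invariant under
translations along `w`; as it is `1` deep inside the half-space and `0` far outside, `w` must be
tangent to the boundary. A nonzero limit from the left is first subtracted as a constant field.
-/

namespace MFG

open Set MeasureTheory.Measure ContinuousLinearMap
open scoped Convolution Pointwise

section HaarMeasure

variable {E : Type*} [NormedAddCommGroup E] [NormedSpace ℝ E] [FiniteDimensional ℝ E]
  [MeasurableSpace E] [BorelSpace E] (μ : Measure E) [μ.IsAddHaarMeasure]

lemma ae_apply_ne_zero {ℓ : E →L[ℝ] ℝ} (hℓ : ℓ ≠ 0) : ∀ᵐ y ∂μ, ℓ y ≠ 0 := by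
  have hker : LinearMap.ker (ℓ : E →ₗ[ℝ] ℝ) ≠ ⊤ := fun h =>
    hℓ (ContinuousLinearMap.coe_injective (LinearMap.ker_eq_top.1 h))
  exact measure_eq_zero_iff_ae_notMem.1 (addHaar_submodule μ _ hker)

lemma eventually_ne_zero_of_hasStrictFDerivAt {f : E → ℝ} {f' : E →L[ℝ] ℝ} {a : E}
    (hf : HasStrictFDerivAt f f' a) (hf' : f' ≠ 0) : ∀ᶠ x in 𝓝 a ⊓ ae μ, f x ≠ 0 := by
  obtain ⟨e, he⟩ := DFunLike.ne_iff.1 hf'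
  obtain ⟨c, hc₀, hc⟩ := exists_pos_mul_lt (nnnorm_pos.2 he) ‖e‖₊
  obtain ⟨s, hs, happrox⟩ := hf.approximates_deriv_on_nhds (Or.inr hc₀)
  obtain ⟨r, hr, hrs⟩ := Metric.nhds_basis_closedBall.mem_iff.1 hs
  have heq_zero : ∀ x ∈ s, ∀ y ∈ s, f x = 0 → f y = 0 → ∀ t : ℝ, x - y = t • e → t = 0 := by
    intro x hx y hy hfx hfy t hxy
    have h := happrox x hx y hy
    rw [hfx, hfy, hxy, sub_zero, zero_sub, norm_neg, map_smul, norm_smul, norm_smul] at h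
    by_contra ht
    have hc' : ‖e‖ * c < ‖f' e‖ := hc
    nlinarith [norm_pos_iff.2 ht, hc']
  set Z : Set E := Metric.closedBall a r ∩ f ⁻¹' {0}
  have hZ : IsClosed Z := (happrox.continuousOn.mono hrs).preimage_isClosed_of_isClosed
    Metric.isClosed_closedBall isClosed_singleton
  let u : ℕ → E := fun n => (1 / ((n : ℝ) + 1)) • e
  have hu : Bornology.IsBounded (range u) := Metric.isBounded_range_of_tendsto u
    (tendsto_one_div_add_atTop_nhds_zero_nat.smul_const e)
  -- `f` is injective along the direction `e` near `a`, so `Z` has infinitely many disjoint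
  -- translates in a bounded set.
  have hdisj : Pairwise (Function.onFun Disjoint fun n => ({u n} : Set E) + Z) := by
    intro i j hij
    rw [Function.onFun, Set.disjoint_left]
    simp only [singleton_add, mem_image, not_exists, not_and, forall_exists_index, and_imp]
    rintro _ x hx rfl y hy hxy
    have hsub : x - y = (1 / ((j : ℝ) + 1) - 1 / ((i : ℝ) + 1)) • e := by
      rw [sub_smul, sub_eq_sub_iff_add_eq_add, add_comm x, add_comm _ y, add_comm y]
      exact hxy.symm
    have hji := sub_eq_zero.1 (heq_zero x (hrs hx.1) y (hrs hy.1) hx.2 hy.2 _ hsub)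
    rw [one_div, one_div, inv_inj, _root_.add_left_inj, Nat.cast_inj] at hji
    exact hij hji.symm
  have hnull := addHaar_eq_zero_of_disjoint_translates μ u hu hdisj hZ.measurableSet
  exact eventually_inf.2 ⟨_, Metric.closedBall_mem_nhds a hr, _,
    measure_eq_zero_iff_ae_notMem.1 hnull, fun x hx hfx => hx.2 ⟨hx.1, hfx⟩⟩

lemma isBoundedUnder_norm_of_tendsto_sides {F : Type*} [NormedAddCommGroup F] {J : E → F}
    {ρ : E → ℝ} {ρ' : E →L[ℝ] ℝ} {x₀ : E} {wL wR : F} (hρ : HasStrictFDerivAt ρ ρ' x₀)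
    (hρ' : ρ' ≠ 0) (hL : Tendsto J (𝓝[{x | ρ x < 0}] x₀) (𝓝 wL))
    (hR : Tendsto J (𝓝[{x | 0 < ρ x}] x₀) (𝓝 wR)) :
    IsBoundedUnder (· ≤ ·) (𝓝 x₀ ⊓ ae μ) fun x => ‖J x‖ := by
  have hsides : 𝓝 x₀ ⊓ ae μ ≤ 𝓝[{x | ρ x < 0}] x₀ ⊔ 𝓝[{x | 0 < ρ x}] x₀ := by
    rw [← nhdsWithin_union]
    refine le_inf inf_le_left (le_principal_iff.2 ?_)
    filter_upwards [eventually_ne_zero_of_hasStrictFDerivAt μ hρ hρ'] with x hx using hx.lt_or_gt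
  refine IsBoundedUnder.mono hsides ?_
  rw [IsBoundedUnder, map_sup]
  exact isBounded_sup hL.norm.isBoundedUnder_le hR.norm.isBoundedUnder_le

lemma map_add_smul_addHaar (x₀ : E) {ε : ℝ} (hε : ε ≠ 0) :
    map (fun y => x₀ + ε • y) μ = ENNReal.ofReal |(ε ^ Module.finrank ℝ E)⁻¹| • μ := by
  have hcomp : (fun y => x₀ + ε • y) = (x₀ + ·) ∘ (ε • ·) := rfl
  rw [hcomp, ← map_map (by fun_prop) (by fun_prop), map_addHaar_smul μ hε, Measure.map_smul,
    map_add_left_eq_self]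

lemma quasiMeasurePreserving_add_smul (x₀ : E) {ε : ℝ} (hε : ε ≠ 0) :
    QuasiMeasurePreserving (fun y => x₀ + ε • y) μ μ :=
  ⟨by fun_prop, map_add_smul_addHaar μ x₀ hε ▸ smul_absolutelyContinuous⟩

lemma integral_fderiv_apply_eq_zero {φ : E → ℝ} (hφ : ContDiff ℝ 1 φ) (hc : HasCompactSupport φ)
    (w : E) : ∫ x, fderiv ℝ φ x w ∂μ = 0 := by
  have hint : Integrable φ μ := hφ.continuous.integrable_of_hasCompactSupport hc
  have hint' : Integrable (fun x => fderiv ℝ φ x w) μ :=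
    ((hφ.continuous_fderiv one_ne_zero).clm_apply continuous_const).integrable_of_hasCompactSupport
      (hc.fderiv_apply (𝕜 := ℝ) w)
  simpa using integral_mul_fderiv_eq_neg_fderiv_mul_of_integrable (μ := μ) (f := fun _ => (1 : ℝ))
    (g := φ) (v := w) (by simp) (by simpa using hint') (by simpa using hint)
    (fun _ _ => differentiableAt_const _) (fun x _ => hφ.differentiable one_ne_zero x)

end HaarMeasure

section BlowUp

variable {E : Type*} [NormedAddCommGroup E] [NormedSpace ℝ E]

lemma tendsto_add_smul_nhds (x₀ y : E) :
    Tendsto (fun ε : ℝ => x₀ + ε • y) (𝓝[>] 0) (𝓝 x₀) := by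
  have h : Continuous fun ε : ℝ => x₀ + ε • y := by fun_prop
  simpa using (h.tendsto 0).mono_left nhdsWithin_le_nhds

lemma tendsto_add_smul_nhdsWithin_pos {ρ : E → ℝ} {ρ' : E →L[ℝ] ℝ} {x₀ y : E}
    (hρ : HasFDerivAt ρ ρ' x₀) (hρ₀ : ρ x₀ = 0) (hy : 0 < ρ' y) :
    Tendsto (fun ε : ℝ => x₀ + ε • y) (𝓝[>] 0) (𝓝[{x | 0 < ρ x}] x₀) := by
  have hslope : Tendsto (fun ε : ℝ => ε⁻¹ • ρ (x₀ + ε • y)) (𝓝[>] 0) (𝓝 (ρ' y)) := by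
    simpa [hρ₀] using (hρ.hasLineDerivAt y).tendsto_slope_zero_right
  refine tendsto_nhdsWithin_iff.2 ⟨tendsto_add_smul_nhds x₀ y, ?_⟩
  filter_upwards [hslope.eventually_const_lt hy, self_mem_nhdsWithin] with ε hpos hε
  exact pos_of_smul_pos_left hpos (inv_nonneg.2 (le_of_lt hε))

lemma tendsto_add_smul_nhdsWithin_neg {ρ : E → ℝ} {ρ' : E →L[ℝ] ℝ} {x₀ y : E}
    (hρ : HasFDerivAt ρ ρ' x₀) (hρ₀ : ρ x₀ = 0) (hy : ρ' y < 0) :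
    Tendsto (fun ε : ℝ => x₀ + ε • y) (𝓝[>] 0) (𝓝[{x | ρ x < 0}] x₀) := by
  simpa using tendsto_add_smul_nhdsWithin_pos (y := y) hρ.neg (by simp [hρ₀]) (by simpa using hy)

lemma tendsto_comp_add_smul_indicator {F : Type*} [Zero F] [TopologicalSpace F] {J : E → F}
    {w : F} {ρ : E → ℝ} {ρ' : E →L[ℝ] ℝ} {x₀ y : E} (hρ : HasFDerivAt ρ ρ' x₀) (hρ₀ : ρ x₀ = 0)
    (hL : Tendsto J (𝓝[{x | ρ x < 0}] x₀) (𝓝 0)) (hR : Tendsto J (𝓝[{x | 0 < ρ x}] x₀) (𝓝 w))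
    (hy : ρ' y ≠ 0) :
    Tendsto (fun ε : ℝ => J (x₀ + ε • y)) (𝓝[>] 0)
      (𝓝 ({y | 0 < ρ' y}.indicator (fun _ => w) y)) := by
  rcases hy.lt_or_gt with hneg | hpos
  · rw [indicator_of_notMem (by simpa using hneg.le)]
    exact hL.comp (tendsto_add_smul_nhdsWithin_neg hρ hρ₀ hneg)
  · rw [indicator_of_mem (by simpa using hpos)]
    exact hR.comp (tendsto_add_smul_nhdsWithin_pos hρ hρ₀ hpos)

lemma eventually_subset_preimage_add_smul {x₀ : E} {Ω K : Set E} (hΩ : Ω ∈ 𝓝 x₀)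
    (hK : IsCompact K) : ∀ᶠ ε : ℝ in 𝓝 0, K ⊆ (fun y => x₀ + ε • y) ⁻¹' Ω := by
  refine hK.eventually_forall_of_forall_eventually fun y _ => ?_
  have hcont : Continuous fun z : ℝ × E => x₀ + z.1 • z.2 := by fun_prop
  have hΩ' : Ω ∈ 𝓝 (x₀ + (0 : ℝ) • y) := by simpa using hΩ
  exact (hcont.tendsto (0, y)).eventually_mem hΩ'

end BlowUp

lemma fderiv_eq_zero_of_notMem_tsupport {E F : Type*} [NormedAddCommGroup E] [NormedSpace ℝ E]
    [NormedAddCommGroup F] [NormedSpace ℝ F] {f : E → F} {x : E} (hx : x ∉ tsupport f) :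
    fderiv ℝ f x = 0 :=
  image_eq_zero_of_notMem_tsupport fun h => hx (tsupport_fderiv_subset ℝ h)

lemma fderiv_comp_const_sub {E F : Type*} [NormedAddCommGroup E] [NormedSpace ℝ E]
    [NormedAddCommGroup F] [NormedSpace ℝ F] {f : E → F} {a y : E}
    (hf : DifferentiableAt ℝ f (a - y)) :
    fderiv ℝ (fun y => f (a - y)) y = -fderiv ℝ f (a - y) := by
  have hsub : HasFDerivAt (fun y => a - y) (-ContinuousLinearMap.id ℝ E) y :=
    (hasFDerivAt_id y).const_sub a
  exact (hf.hasFDerivAt.comp y hsub).fderiv.trans (by simp)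

section DivergenceFree

variable {E : Type*} [NormedAddCommGroup E] [NormedSpace ℝ E] [MeasurableSpace E]
  {μ : Measure E} {J : E → E} {Ω : Set E}

/-- The locally integrable vector field `J` satisfies `div J = 0` in `Ω` in the sense of
distributions with respect to `μ`. Since `φ` is supported in `Ω`, the integral over the whole space
only sees `J` on `Ω`, and `fderiv ℝ φ x (J x)` is the pairing `∇φ · J` without an inner product. -/
structure IsDivFreeOn (μ : Measure E) (J : E → E) (Ω : Set E) : Prop where
  locallyIntegrableOn : LocallyIntegrableOn J Ω μ
  integral_fderiv_eq_zero : ∀ φ : E → ℝ, ContDiff ℝ ∞ φ → HasCompactSupport φ → tsupport φ ⊆ Ω →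
    ∫ x, fderiv ℝ φ x (J x) ∂μ = 0

variable [BorelSpace E] [FiniteDimensional ℝ E]

lemma integrable_fderiv_apply (hJ : LocallyIntegrableOn J Ω μ) {φ : E → ℝ}
    (hφ : ContDiff ℝ 1 φ) (hc : HasCompactSupport φ) (hφΩ : tsupport φ ⊆ Ω) :
    Integrable (fun x => fderiv ℝ φ x (J x)) μ := by
  have hφ' : Continuous (fderiv ℝ φ) := hφ.continuous_fderiv one_ne_zero
  obtain ⟨C, hC⟩ := (hc.fderiv (𝕜 := ℝ)).exists_bound_of_continuous hφ'
  have hJφ : IntegrableOn J (tsupport φ) μ := hJ.integrableOn_compact_subset hφΩ hc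
  rw [← integrableOn_iff_integrable_of_support_subset (s := tsupport φ)
    (Function.support_subset_iff'.2 fun x hx => by simp [fderiv_eq_zero_of_notMem_tsupport hx])]
  refine (hJφ.norm.const_mul C).mono' ?_ (Eventually.of_forall fun x =>
    (fderiv ℝ φ x).le_of_opNorm_le (hC x) (J x))
  exact (isBoundedBilinearMap_apply (𝕜 := ℝ) (E := E) (F := ℝ)).continuous
    |>.comp_aestronglyMeasurable₂ hφ'.aestronglyMeasurable hJφ.aestronglyMeasurable

variable [μ.IsAddHaarMeasure]

lemma IsDivFreeOn.sub_const (hJ : IsDivFreeOn μ J Ω) (w : E) :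
    IsDivFreeOn μ (fun x => J x - w) Ω := by
  have hw : LocallyIntegrableOn (fun _ => w) Ω μ :=
    (locallyIntegrable_const w).locallyIntegrableOn Ω
  refine ⟨hJ.locallyIntegrableOn.sub hw, fun φ hφ hc hφΩ => ?_⟩
  have hφ₁ : ContDiff ℝ 1 φ := hφ.of_le (by simp)
  simp only [map_sub]
  rw [integral_sub (integrable_fderiv_apply hJ.locallyIntegrableOn hφ₁ hc hφΩ)
    (integrable_fderiv_apply hw hφ₁ hc hφΩ), hJ.integral_fderiv_eq_zero φ hφ hc hφΩ,
    integral_fderiv_apply_eq_zero μ hφ₁ hc, sub_zero]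

lemma IsDivFreeOn.comp_add_smul (hJ : IsDivFreeOn μ J Ω) (x₀ : E) {ε : ℝ} (hε : ε ≠ 0) :
    IsDivFreeOn μ (fun y => J (x₀ + ε • y)) ((fun y => x₀ + ε • y) ⁻¹' Ω) := by
  set T : E ≃ₜ E := (Homeomorph.smulOfNeZero ε hε).trans (Homeomorph.addLeft x₀)
  have hT : ∀ y, T y = x₀ + ε • y := fun y => rfl
  have hTμ : map T μ = ENNReal.ofReal |(ε ^ Module.finrank ℝ E)⁻¹| • μ :=
    map_add_smul_addHaar μ x₀ hε
  refine ⟨fun y hy => ?_, fun φ hφ hc hφΩ => ?_⟩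
  · obtain ⟨s, hs, hJs⟩ := hJ.locallyIntegrableOn (T y) hy
    refine ⟨T ⁻¹' s, T.continuous.continuousWithinAt.preimage_mem_nhdsWithin' ?_, ?_⟩
    · exact nhdsWithin_mono _ (image_preimage_subset _ _) hs
    · refine (T.measurableEmbedding.integrableOn_map_iff (f := J)).1 ?_
      rw [hTμ, IntegrableOn, Measure.restrict_smul]
      exact hJs.smul_measure ENNReal.ofReal_ne_top
  · set ψ : E → ℝ := φ ∘ T.symm with hψ
    have hψΩ : tsupport ψ ⊆ Ω := fun x hx => by
      simpa [← hT] using hφΩ (tsupport_comp_subset_preimage φ T.symm.continuous hx)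
    have hψ_smooth : ContDiff ℝ ∞ ψ := hφ.comp (g := φ) <| by
      change ContDiff ℝ ∞ fun x => ε⁻¹ • (-x₀ + x)
      fun_prop
    have hfderiv : ∀ y, fderiv ℝ φ y = ε • fderiv ℝ ψ (T y) := fun y => by
      have hφψ : φ = fun y => ψ (x₀ + ε • y) := by
        ext y
        simp [hψ, ← hT]
      rw [hφψ, fderiv_comp_smul (f := fun z => ψ (x₀ + z)), fderiv_comp_add_left, hT]
    calc ∫ y, fderiv ℝ φ y (J (T y)) ∂μ
        = ε * ∫ y, fderiv ℝ ψ (T y) (J (T y)) ∂μ := by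
          simp only [hfderiv, _root_.smul_apply, smul_eq_mul, integral_const_mul]
      _ = ε * ∫ x, fderiv ℝ ψ x (J x) ∂(map T μ) := by
          rw [T.measurableEmbedding.integral_map]
      _ = 0 := by
          rw [hTμ, integral_smul_measure,
            hJ.integral_fderiv_eq_zero ψ hψ_smooth (hc.comp_homeomorph T.symm) hψΩ]
          simp

lemma IsDivFreeOn.blowUp (hJ : IsDivFreeOn μ J Ω) {x₀ : E} (hΩ : Ω ∈ 𝓝 x₀)
    (hbdd : IsBoundedUnder (· ≤ ·) (𝓝 x₀ ⊓ ae μ) fun x => ‖J x‖) {K : E → E}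
    (hK : LocallyIntegrable K μ)
    (hlim : ∀ᵐ y ∂μ, Tendsto (fun ε : ℝ => J (x₀ + ε • y)) (𝓝[>] 0) (𝓝 (K y))) :
    IsDivFreeOn μ K univ := by
  refine ⟨hK.locallyIntegrableOn univ, fun φ hφ hc _ => ?_⟩
  have hφ₁ : ContDiff ℝ 1 φ := hφ.of_le (by simp)
  have hφ' : Continuous (fderiv ℝ φ) := hφ₁.continuous_fderiv one_ne_zero
  obtain ⟨M, hM⟩ := hbdd
  obtain ⟨s, hs, t, ht, hst⟩ := eventually_inf.1 (eventually_map.1 hM)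
  have hsmall : ∀ᶠ ε : ℝ in 𝓝[>] 0, ε ≠ 0 ∧ tsupport φ ⊆ (fun y => x₀ + ε • y) ⁻¹' (Ω ∩ s) :=
    (eventually_mem_nhdsWithin.mono fun _ h => ne_of_gt h).and
      ((eventually_subset_preimage_add_smul (inter_mem hΩ hs) hc).filter_mono nhdsWithin_le_nhds)
  have hrescaled : ∀ᶠ ε : ℝ in 𝓝[>] 0, ∫ y, fderiv ℝ φ y (J (x₀ + ε • y)) ∂μ = 0 := by
    filter_upwards [hsmall] with ε ⟨hε, hsupp⟩
    exact (hJ.comp_add_smul x₀ hε).integral_fderiv_eq_zero φ hφ hc fun y hy => (hsupp hy).1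
  have hconv : Tendsto (fun ε : ℝ => ∫ y, fderiv ℝ φ y (J (x₀ + ε • y)) ∂μ) (𝓝[>] 0)
      (𝓝 (∫ y, fderiv ℝ φ y (K y) ∂μ)) := by
    refine tendsto_integral_filter_of_dominated_convergence (fun y => ‖fderiv ℝ φ y‖ * M)
      ?_ ?_ ?_ ?_
    · filter_upwards [hsmall] with ε ⟨hε, hsupp⟩
      exact (integrable_fderiv_apply (hJ.comp_add_smul x₀ hε).locallyIntegrableOn hφ₁ hc
        fun y hy => (hsupp hy).1).aestronglyMeasurable
    · filter_upwards [hsmall] with ε ⟨hε, hsupp⟩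
      filter_upwards [(quasiMeasurePreserving_add_smul μ x₀ hε).ae ht] with y hy
      by_cases hyφ : y ∈ tsupport φ
      · exact (fderiv ℝ φ y).le_opNorm_of_le (hst _ ⟨(hsupp hyφ).2, hy⟩)
      · simp [fderiv_eq_zero_of_notMem_tsupport hyφ]
    · exact (hφ'.norm.mul continuous_const).integrable_of_hasCompactSupport
        (hc.fderiv (𝕜 := ℝ)).norm.mul_right
    · filter_upwards [hlim] with y hy using ((fderiv ℝ φ y).continuous.tendsto _).comp hy
  exact tendsto_nhds_unique (hconv.congr' hrescaled) tendsto_const_nhds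

lemma IsDivFreeOn.convolution_add_smul {g : E → ℝ} {w : E}
    (hw : IsDivFreeOn μ (fun y => g y • w) univ) (hg : LocallyIntegrable g μ) {φ : E → ℝ}
    (hφ : ContDiff ℝ ∞ φ) (hc : HasCompactSupport φ) (x : E) (t : ℝ) :
    (φ ⋆[lsmul ℝ ℝ, μ] g) (x + t • w) = (φ ⋆[lsmul ℝ ℝ, μ] g) x := by
  have hφ₁ : ContDiff ℝ 1 φ := hφ.of_le (by simp)
  have hderiv_w : ∀ z, ∫ y, fderiv ℝ φ (z - y) w * g y ∂μ = 0 := fun z => by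
    have htest := hw.integral_fderiv_eq_zero (fun y => φ (z - y)) (hφ.comp (by fun_prop))
      (hc.comp_homeomorph (Homeomorph.subLeft z)) (subset_univ _)
    simpa [fderiv_comp_const_sub (hφ₁.differentiable one_ne_zero _), integral_neg, mul_comm]
      using htest
  have hderiv : ∀ s : ℝ, HasDerivAt (fun s : ℝ => (φ ⋆[lsmul ℝ ℝ, μ] g) (x + s • w)) 0 s := by
    intro s
    have hline : HasDerivAt (fun s : ℝ => x + s • w) w s := by
      simpa using ((hasDerivAt_id s).smul_const w).const_add x
    have hconv := hc.hasFDerivAt_convolution_right (lsmul ℝ ℝ).flip hg hφ₁ (x + s • w)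
    rw [convolution_flip] at hconv
    have hvalue :
        (g ⋆[(lsmul ℝ ℝ).flip.precompR E, μ] fderiv ℝ φ) (x + s • w) w = 0 := by
      rw [convolution_precompR_apply _ hg (hc.fderiv (𝕜 := ℝ))
        (hφ₁.continuous_fderiv one_ne_zero)]
      simpa [convolution_def] using hderiv_w (x + s • w)
    have hcomp := hconv.comp_hasDerivAt s hline
    rwa [hvalue] at hcomp
  simpa using is_const_of_deriv_eq_zero (fun s => (hderiv s).differentiableAt)
    (fun s => (hderiv s).deriv) t 0

lemma normed_convolution_indicator_halfSpace (φ : ContDiffBump (0 : E)) {ℓ : E →L[ℝ] ℝ} {x : E}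
    (hx : φ.rOut * ‖ℓ‖ ≤ |ℓ x|) :
    (φ.normed μ ⋆[lsmul ℝ ℝ, μ] ({y | 0 < ℓ y}.indicator 1 : E → ℝ)) x =
      {y | 0 < ℓ y}.indicator 1 x := by
  refine φ.normed_convolution_eq_right fun y hy => ?_
  have hsign : 0 < ℓ y ↔ 0 < ℓ x := by
    rcases eq_or_ne ℓ 0 with rfl | hℓ
    · simp
    have hxy : |ℓ y - ℓ x| < |ℓ x| := calc
      |ℓ y - ℓ x| = ‖ℓ (y - x)‖ := by rw [map_sub, Real.norm_eq_abs]
      _ ≤ ‖ℓ‖ * ‖y - x‖ := ℓ.le_opNorm _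
      _ < ‖ℓ‖ * φ.rOut := mul_lt_mul_of_pos_left (mem_ball_iff_norm.1 hy) (norm_pos_iff.2 hℓ)
      _ ≤ |ℓ x| := by rwa [mul_comm]
    grind
  simp [indicator_apply, hsign]

lemma IsDivFreeOn.apply_eq_zero_of_halfSpace {ℓ : E →L[ℝ] ℝ} {w : E}
    (hw : IsDivFreeOn μ ({y | 0 < ℓ y}.indicator fun _ => w) univ) : ℓ w = 0 := by
  by_contra hℓw
  set g : E → ℝ := {y | 0 < ℓ y}.indicator 1
  have hg : LocallyIntegrable g μ := (locallyIntegrable_const 1).indicator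
    (isOpen_lt continuous_const ℓ.continuous).measurableSet
  have hgw : IsDivFreeOn μ (fun y => g y • w) univ := by
    convert hw using 2 with y
    simp [g, indicator_apply]
  let φ : ContDiffBump (0 : E) := default
  let F : E → ℝ := φ.normed μ ⋆[lsmul ℝ ℝ, μ] g
  have hℓ : 0 < ‖ℓ‖ := norm_pos_iff.2 fun h => hℓw (by simp [h])
  have hF_far : ∀ x, φ.rOut * ‖ℓ‖ ≤ |ℓ x| → F x = g x := fun x hx =>
    normed_convolution_indicator_halfSpace φ hx
  have hF_const : ∀ t : ℝ, F (t • w) = F 0 := fun t => by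
    simpa using hgw.convolution_add_smul hg φ.contDiff_normed φ.hasCompactSupport_normed 0 t
  set s : ℝ := φ.rOut * ‖ℓ‖ / ℓ w
  have hs : ℓ (s • w) = φ.rOut * ‖ℓ‖ := by simp [s, hℓw]
  have hs_pos : 0 < ℓ (s • w) := hs ▸ mul_pos φ.rOut_pos hℓ
  have hneg : ℓ ((-s) • w) = -ℓ (s • w) := by simp
  have hF_one : F (s • w) = 1 := by
    rw [hF_far _ (hs ▸ le_abs_self _)]
    exact indicator_of_mem (s := {y | 0 < ℓ y}) hs_pos 1
  have hF_zero : F ((-s) • w) = 0 := by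
    rw [hF_far _ (by rw [hneg, abs_neg, ← hs]; exact le_abs_self _)]
    exact indicator_of_notMem (s := {y | 0 < ℓ y}) (fun h => by linarith [mem_ofPred.1 h]) 1
  linarith [hF_const s, hF_const (-s)]

lemma IsDivFreeOn.apply_eq_zero_of_tendsto_sides (hJ : IsDivFreeOn μ J Ω) {x₀ w : E}
    (hΩ : Ω ∈ 𝓝 x₀) {ρ : E → ℝ} {ρ' : E →L[ℝ] ℝ} (hρ : HasStrictFDerivAt ρ ρ' x₀)
    (hρ₀ : ρ x₀ = 0) (hL : Tendsto J (𝓝[{x | ρ x < 0}] x₀) (𝓝 0))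
    (hR : Tendsto J (𝓝[{x | 0 < ρ x}] x₀) (𝓝 w)) : ρ' w = 0 := by
  by_cases hρ' : ρ' = 0
  · simp [hρ']
  have hhalf : LocallyIntegrable ({y | 0 < ρ' y}.indicator fun _ => w) μ :=
    (locallyIntegrable_const w).indicator
      (isOpen_lt continuous_const ρ'.continuous).measurableSet
  refine (hJ.blowUp hΩ (isBoundedUnder_norm_of_tendsto_sides μ hρ hρ' hL hR) hhalf ?_)
    |>.apply_eq_zero_of_halfSpace
  filter_upwards [ae_apply_ne_zero μ hρ'] with y hy
  exact tendsto_comp_add_smul_indicator hρ.hasFDerivAt hρ₀ hL hR hy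

theorem IsDivFreeOn.rankineHugoniot (hJ : IsDivFreeOn μ J Ω) {x₀ wL wR : E} (hΩ : Ω ∈ 𝓝 x₀)
    {ρ : E → ℝ} {ρ' : E →L[ℝ] ℝ} (hρ : HasStrictFDerivAt ρ ρ' x₀) (hρ₀ : ρ x₀ = 0)
    (hL : Tendsto J (𝓝[{x | ρ x < 0}] x₀) (𝓝 wL)) (hR : Tendsto J (𝓝[{x | 0 < ρ x}] x₀) (𝓝 wR)) :
    ρ' (wR - wL) = 0 :=
  (hJ.sub_const wL).apply_eq_zero_of_tendsto_sides hΩ hρ hρ₀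
    (by simpa using hL.sub_const wL) (hR.sub_const wL)

end DivergenceFree

section MeanFieldGame

variable {d : ℕ}

/-- The flux `m D_pH(x, v)` of the continuity equation, where `v` is a representative of `Du`. -/
noncomputable def flux (H : Euc d → Euc d → ℝ) (m : Euc d → ℝ) (v : Euc d → Euc d)
    (x : Euc d) : Euc d :=
  m x • gradP H x (v x)

lemma continuousAt_gradP {H : Euc d → Euc d → ℝ} {x p : Euc d}
    (hH : ContDiffAt ℝ 1 (fun z : Euc d × Euc d => H z.1 z.2) (x, p)) :
    ContinuousAt (fun z : Euc d × Euc d => gradP H z.1 z.2) (x, p) := by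
  have hH' : ContDiffAt ℝ 1
      (Function.uncurry fun (z : Euc d × Euc d) (q : Euc d) => H z.1 q) ((x, p), p) :=
    hH.comp ((x, p), p) (f := fun z : (Euc d × Euc d) × Euc d => (z.1.1, z.2)) (by fun_prop)
  have hfderiv : ContDiffAt ℝ 0
      (fun z : Euc d × Euc d => fderiv ℝ (fun q => H z.1 q) z.2) (x, p) :=
    ContDiffAt.fderiv (f := fun (z : Euc d × Euc d) (q : Euc d) => H z.1 q) hH' contDiffAt_snd
      (by norm_num)
  exact (InnerProductSpace.toDual ℝ (Euc d)).symm.continuous.continuousAt.comp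
    hfderiv.continuousAt

lemma IsWeakSolution.isDivFreeOn_flux {Ω : Set (Euc d)} {G : ℝ → ℝ} {H : Euc d → Euc d → ℝ}
    {α β : ℝ} {m u : Euc d → ℝ} {v : Euc d → Euc d} (hsol : IsWeakSolution Ω G H α β m u v) :
    IsDivFreeOn volume (flux H m v) Ω := by
  refine ⟨hsol.flux_integrable.locallyIntegrableOn, fun φ hφ hc hφΩ => ?_⟩
  rw [← setIntegral_eq_integral_of_forall_compl_eq_zero (s := Ω) fun x hx => by
    simp [fderiv_eq_zero_of_notMem_tsupport fun h => hx (hφΩ h)]]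
  simpa only [inner_gradient_right, conj_trivial, flux] using hsol.continuity φ ⟨hφ, hc, hφΩ⟩

lemma tendsto_flux {H : Euc d → Euc d → ℝ} {m : Euc d → ℝ} {v : Euc d → Euc d} {s : Set (Euc d)}
    {x₀ vR : Euc d} {mR : ℝ} (hH : ContDiffAt ℝ 1 (fun z : Euc d × Euc d => H z.1 z.2) (x₀, vR))
    (hm : Tendsto m (𝓝[s] x₀) (𝓝 mR)) (hv : Tendsto v (𝓝[s] x₀) (𝓝 vR)) :
    Tendsto (flux H m v) (𝓝[s] x₀) (𝓝 (mR • gradP H x₀ vR)) :=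
  hm.smul ((continuousAt_gradP hH).tendsto.comp
    ((tendsto_id.mono_left nhdsWithin_le_nhds).prodMk_nhds hv))

section Hypersurface

variable {F U VL VR : Set (Euc d)} {x₀ : Euc d} {ρ : Euc d → ℝ}

lemma DividesC1.mem_nhds (h : DividesC1 F x₀ U VL VR ρ) : U ∈ 𝓝 x₀ :=
  h.isOpen.mem_nhds h.mem

lemma DividesC1.hasStrictFDerivAt (h : DividesC1 F x₀ U VL VR ρ) :
    HasStrictFDerivAt ρ (fderiv ℝ ρ x₀) x₀ :=
  (h.contDiffOn.contDiffAt h.mem_nhds).hasStrictFDerivAt one_ne_zero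

lemma DividesC1.apply_eq_zero (h : DividesC1 F x₀ U VL VR ρ) (hx₀ : x₀ ∈ F) : ρ x₀ = 0 :=
  (h.eq_zero.subset ⟨hx₀, h.mem⟩).2

lemma DividesC1.nhdsWithin_left (h : DividesC1 F x₀ U VL VR ρ) :
    𝓝[VL] x₀ = 𝓝[{x | ρ x < 0}] x₀ := by
  rw [h.left_eq]
  exact nhdsWithin_inter_of_mem (mem_nhdsWithin_of_mem_nhds h.mem_nhds)

lemma DividesC1.nhdsWithin_right (h : DividesC1 F x₀ U VL VR ρ) :
    𝓝[VR] x₀ = 𝓝[{x | 0 < ρ x}] x₀ := by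
  rw [h.right_eq]
  exact nhdsWithin_inter_of_mem (mem_nhdsWithin_of_mem_nhds h.mem_nhds)

lemma IsUnitNormal.inner_eq_zero {ν w : Euc d} (hν : IsUnitNormal ρ x₀ ν)
    (hw : fderiv ℝ ρ x₀ w = 0) : inner ℝ w ν = 0 := by
  obtain ⟨-, c, rfl⟩ := hν
  rw [inner_smul_right, real_inner_comm, inner_gradient_left, hw, mul_zero]

end Hypersurface

end MeanFieldGame

end MFG

theorem mainTheorem8_general {d : ℕ} {Ω F U VL VR : Set (MFG.Euc d)}
    {H : MFG.Euc d → MFG.Euc d → ℝ} {m : MFG.Euc d → ℝ} {v : MFG.Euc d → MFG.Euc d}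
    (hflux : MFG.IsDivFreeOn volume (MFG.flux H m v) Ω) {x₀ : MFG.Euc d} (hΩ : Ω ∈ 𝓝 x₀)
    (hx₀ : x₀ ∈ F) {ρ : MFG.Euc d → ℝ} (hdiv : MFG.DividesC1 F x₀ U VL VR ρ)
    {ν : MFG.Euc d} (hν : MFG.IsUnitNormal ρ x₀ ν)
    {wL : MFG.Euc d} (hL : Tendsto (MFG.flux H m v) (𝓝[VL] x₀) (𝓝 wL))
    {mR : ℝ} (hmR : Tendsto m (𝓝[VR] x₀) (𝓝 mR))
    {vR : MFG.Euc d} (hvR : Tendsto v (𝓝[VR] x₀) (𝓝 vR))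
    (hH : ContDiffAt ℝ 1 (fun z : MFG.Euc d × MFG.Euc d => H z.1 z.2) (x₀, vR)) :
    inner ℝ (mR • MFG.gradP H x₀ vR - wL) ν = 0 := by
  have hR := MFG.tendsto_flux hH hmR hvR
  rw [hdiv.nhdsWithin_left] at hL
  rw [hdiv.nhdsWithin_right] at hR
  exact hν.inner_eq_zero
    (hflux.rankineHugoniot hΩ hdiv.hasStrictFDerivAt (hdiv.apply_eq_zero hx₀) hL hR)

theorem mainTheorem8 {d : ℕ} (Ω : Set (MFG.Euc d))
    (hΩo : IsOpen Ω) (hΩb : Bornology.IsBounded Ω) (hΩc : IsConnected Ω)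
    (G : ℝ → ℝ) (H : MFG.Euc d → MFG.Euc d → ℝ) (α β : ℝ)
    (hG : MFG.EnergyAssumption G α) (hH : MFG.HamiltonianAssumption Ω H β)
    (m u : MFG.Euc d → ℝ) (v : MFG.Euc d → MFG.Euc d)
    (hsol : MFG.IsWeakSolution Ω G H α β m u v)
    (x₀ : MFG.Euc d) (hx₀ : x₀ ∈ MFG.freeBoundary Ω m)
    (U VL VR : Set (MFG.Euc d)) (ρ : MFG.Euc d → ℝ) (hUΩ : U ⊆ Ω)
    (hdiv : MFG.DividesC1 (MFG.freeBoundary Ω m) x₀ U VL VR ρ)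
    (hL : ∀ x ∈ VL, m x = 0) (hR : ∀ x ∈ VR, 0 < m x)
    (ν : MFG.Euc d) (hν : MFG.IsUnitNormal ρ x₀ ν)
    (mR : ℝ) (hmR : Tendsto m (𝓝[VR] x₀) (𝓝 mR))
    (vR : MFG.Euc d) (hvR : Tendsto v (𝓝[VR] x₀) (𝓝 vR)) :
    inner ℝ (mR • MFG.gradP H x₀ vR) ν = 0 := by
  have hΩ : Ω ∈ 𝓝 x₀ := hΩo.mem_nhds hx₀.2
  have hH₁ : ContDiffAt ℝ 1 (fun z : MFG.Euc d × MFG.Euc d => H z.1 z.2) (x₀, vR) :=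
    (hH.contDiffOn.contDiffAt (prod_mem_nhds (mem_of_superset hΩ subset_closure) univ_mem)).of_le
      one_le_two
  have hfluxL : Tendsto (MFG.flux H m v) (𝓝[VL] x₀) (𝓝 0) :=
    tendsto_nhdsWithin_congr (fun x hx => by simp [MFG.flux, hL x hx]) tendsto_const_nhds
  simpa using mainTheorem8_general hsol.isDivFreeOn_flux hΩ hx₀ hdiv hν hfluxL hmR hvR hH₁
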